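/- Let $\Delta$ be the root system of a complex simple Lie algebra of type $A_\ell$ ($\ell$ odd), $D_\ell$ ($\ell\ge 4$), $E_6$, $E_7$ or $E_8$. Let $\Pi=\{\alpha_i\}_{i\in I}$, $\mathrm{card}\,I=\ell$, be a base of $\Delta$, let $\Delta_+$ be the corresponding set of positive roots and $\psi$ the highest root, and let $h$ be the Coxeter number, so that $\mathrm{card}\,\Delta=h\ell$. For $i\in I$ let $s_i$ be the reflection defined by $\alpha_i$. There is a unique partition $I=I_1\sqcup I_2$ such that, for $k=1,2$, the roots $\alpha_i$ and $\alpha_j$ are orthogonal whenever $i\ne j$ lie in $I_k$, and such that $\alpha_i$ is orthogonal to $\psi$ for every $i\in I_2$. With this partition put $\tau_k=\prod_{i\in I_k}s_i$ (the factors commute), let $\sigma=\tau_2\tau_1$ (a Coxeter element), let $Z$ be the cyclic group generated by $\sigma$, and put $\beta_i=\alpha_i$ if $i\in I_1$ and $\beta_i=-\alpha_i$ if $i\in I_2$. Let $\varphi\in\Delta_+$. Then there is a unique $i_\varphi\in I$ with $\varphi\in Z\cdot\beta_{i_\varphi}$. Let $k_\varphi\in\{1,2\}$ be such that $i_\varphi\in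 I_{k_\varphi}$. Then there is a unique integer $n(\varphi)$ with $1\le n(\varphi)\le h$, of the same parity as $k_\varphi$, such that $$\sigma^{\frac{n(\varphi)-1}{2}}(\varphi)=\beta_{i_\varphi}\ \text{ if } k_\varphi=1,\qquad \sigma^{\frac{n(\varphi)}{2}}(\varphi)=\beta_{i_\varphi}\ \text{ if } k_\varphi=2.$$ -/

import Mathlib

namespace RootPairing.Base

section

variable {ι R M N : Type*} [Field R] [CharZero R] [AddCommGroup M] [Module R M]
  [AddCommGroup N] [Module R N] {P : RootPairing ι R M N}

/-- `P`, with base `b`, is of one of the types `A_ℓ` (`ℓ` odd), `D_ℓ` (`4 ≤ ℓ`), `E₆`, `E₇`, `E₈`: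
after a suitable numbering of the simple roots, its Cartan matrix is the standard one. -/
def IsTypeAOddOrDOrE [P.IsCrystallographic] (b : P.Base) : Prop :=
  (∃ n : ℕ, ∃ e : b.support ≃ Fin (2 * n + 1),
      b.cartanMatrix = (CartanMatrix.A (2 * n + 1)).submatrix e e) ∨
  (∃ n : ℕ, 4 ≤ n ∧ ∃ e : b.support ≃ Fin n,
      b.cartanMatrix = (CartanMatrix.D n).submatrix e e) ∨
  (∃ e : b.support ≃ Fin 6, b.cartanMatrix = CartanMatrix.E₆.submatrix e e) ∨
  (∃ e : b.support ≃ Fin 7, b.cartanMatrix = CartanMatrix.E₇.submatrix e e) ∨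
  (∃ e : b.support ≃ Fin 8, b.cartanMatrix = CartanMatrix.E₈.submatrix e e)

/-- The Coxeter number `h` of an irreducible root system of rank `ℓ`, determined by
`h * ℓ = card Δ` (equivalently `(h + 1) * ℓ = dim 𝔤` for the corresponding simple Lie algebra);
the division is exact for every irreducible reduced root system. -/
noncomputable def coxeterNumber (b : P.Base) : ℕ :=
  Nat.card ι / b.support.card

/-- `ψ` is (the index of) the highest root: `ψ - φ` is a sum of simple roots for every root `φ`. -/
def IsHighestRoot (b : P.Base) (ψ : ι) : Prop :=
  ∀ φ : ι, P.root ψ - P.root φ ∈ AddSubmonoid.closure (P.root '' b.support)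

/-- A partition `I = I₁ ⊔ I₂` of the index set of the simple roots such that distinct simple roots
in the same part are orthogonal, and such that all simple roots in the second part are orthogonal
to the root `ψ` (which will be the highest root). -/
@[ext]
structure Bipartition (b : P.Base) (ψ : ι) where
  /-- The first part `I₁`. -/
  I₁ : Finset b.support
  /-- The second part `I₂`. -/
  I₂ : Finset b.support
  disjoint : Disjoint I₁ I₂
  mem_or_mem : ∀ i, i ∈ I₁ ∨ i ∈ I₂
  orthogonal₁ : ∀ i ∈ I₁, ∀ j ∈ I₁, i ≠ j → P.IsOrthogonal i j
  orthogonal₂ : ∀ i ∈ I₂, ∀ j ∈ I₂, i ≠ j → P.IsOrthogonal i j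
  orthogonal_highest : ∀ i ∈ I₂, P.IsOrthogonal i ψ

namespace Bipartition

variable {b : P.Base} {ψ : ι} (S : b.Bipartition ψ)

/-- `τ₁ = ∏_{i ∈ I₁} s_i`, the product of the commuting simple reflections of the first part. -/
noncomputable def τ₁ : M ≃ₗ[R] M :=
  S.I₁.noncommProd (fun i ↦ P.reflection i)
    fun i hi j hj hij ↦ P.isOrthogonal_comm i j (S.orthogonal₁ i hi j hj hij)

/-- `τ₂ = ∏_{i ∈ I₂} s_i`, the product of the commuting simple reflections of the second part. -/
noncomputable def τ₂ : M ≃ₗ[R] M :=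
  S.I₂.noncommProd (fun i ↦ P.reflection i)
    fun i hi j hj hij ↦ P.isOrthogonal_comm i j (S.orthogonal₂ i hi j hj hij)

/-- The Coxeter element `σ = τ₂ τ₁` (first `τ₁`, then `τ₂`). -/
noncomputable def σ : M ≃ₗ[R] M :=
  S.τ₂ * S.τ₁

open Classical in
/-- The number `k ∈ {1, 2}` of the part that contains `i`. -/
noncomputable def k (i : b.support) : ℕ :=
  if i ∈ S.I₁ then 1 else 2

open Classical in
/-- `β_i = α_i` if `i ∈ I₁`, and `β_i = -α_i` if `i ∈ I₂`. -/
noncomputable def β (i : b.support) : M :=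
  if i ∈ S.I₁ then P.root i else -P.root i

/-- The orbit `Z · x` of `x` under the cyclic group `Z` generated by `σ`. -/
def orbit (x : M) : Set M :=
  MulAction.orbit (Subgroup.zpowers S.σ) x

end Bipartition

end

end RootPairing.Base

/-! Let `A` be 2 minus the Cartan matrix. The Dynkin diagram is bipartite, so applying `τ₁` and `τ₂`
alternately to a simple root obeys a two-term recurrence, solved by Chebyshev-type polynomials in
`A`. For each `i` this gives a sequence `zigzag n i` of roots running through `-α_i` at `n = 0` and
`α_i` at `n = 1`, with `zigzag (1 - n) = -zigzag n`. Each half of the Coxeter element moves the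
index by one, so `σ` moves it by two (`τ₁_zigzag`, `τ₂_zigzag`).

Let `H` be maximal such that all zigzags are positive for indices from 1 to `H`. Nonnegativity and
connectedness force the `H`-th polynomial to vanish at `A` (`exists_isHalfPeriod`), so the zigzags
have period `2H`, positive on `[1, H]` and negative on `[1 - H, 0]`. These signs separate the orbits
of the `β_i` (`eq_of_β_mem_orbit`). Each orbit has `H` elements and together they exhaust the roots,
so `H` is the Coxeter number (`card_eq_mul`).

After `H` half-steps every positive root has become negative (`isPosRoot_neg_halfSteps`). The
half-step at which a given root first changes sign meets a simple root, which yields `i_φ` and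
`n(φ)` (`exists_σ_pow_eq_β`).

The classification enters only through the partition: all simple roots not orthogonal to `ψ` must
have one colour (`even_rank_add_rank`), and connectedness then makes the partition unique. -/

set_option linter.unusedSectionVars false

/-! ### Vieta–Fibonacci polynomials of an integer matrix -/

open Polynomial in
/-- The values at a matrix `A` of the Vieta–Fibonacci polynomials, shifted so that the sequence is
odd: `U 0 = 0`, `U 1 = 1` and `U (n + 1) = U n * A - U (n - 1)`. -/
noncomputable def Matrix.vietaFibonacci {I : Type*} [Fintype I] [DecidableEq I]
    (A : Matrix I I ℤ) (n : ℤ) : Matrix I I ℤ :=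
  aeval A (Chebyshev.S ℤ (n - 1))

namespace Matrix

variable {I : Type*} [Fintype I] [DecidableEq I] (A : Matrix I I ℤ)

lemma vietaFibonacci_zero : A.vietaFibonacci 0 = 0 := by
  simp [vietaFibonacci]

lemma vietaFibonacci_one : A.vietaFibonacci 1 = 1 := by
  simp [vietaFibonacci]

lemma vietaFibonacci_neg (n : ℤ) : A.vietaFibonacci (-n) = -A.vietaFibonacci n := by
  simp [vietaFibonacci, Polynomial.Chebyshev.S_neg_sub_one]

lemma vietaFibonacci_add_one (n : ℤ) :
    A.vietaFibonacci (n + 1) = A.vietaFibonacci n * A - A.vietaFibonacci (n - 1) := by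
  have h := Polynomial.Chebyshev.S_add_one ℤ (n - 1)
  rw [mul_comm] at h
  simpa [vietaFibonacci] using congrArg (Polynomial.aeval A) h

lemma vietaFibonacci_mul_comm (n : ℤ) :
    A.vietaFibonacci n * A = A * A.vietaFibonacci n := by
  have := congrArg (Polynomial.aeval A) (mul_comm (Polynomial.Chebyshev.S ℤ (n - 1)) Polynomial.X)
  simpa [vietaFibonacci] using this

variable {A}

/-- `A` reverses the colour `c`, and the polynomial of index `n` contains only powers of the parity
of `n - 1`. -/
lemma vietaFibonacci_apply_eq_zero {c : I → ℤ} (hc : ∀ i j, A i j ≠ 0 → Odd (c i + c j))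
    {n : ℤ} {i j : I} (h : Even (n + c i + c j)) : A.vietaFibonacci n i j = 0 := by
  suffices key : ∀ n : ℕ, (∀ i j, Even ((n : ℤ) + c i + c j) → A.vietaFibonacci n i j = 0) ∧
      ∀ i j, Even (((n + 1 : ℕ) : ℤ) + c i + c j) → A.vietaFibonacci (n + 1 : ℕ) i j = 0 by
    obtain ⟨m, rfl | rfl⟩ := n.eq_nat_or_neg
    · exact (key m).1 i j h
    · rw [vietaFibonacci_neg, neg_apply, (key m).1 i j (by grind), neg_zero]
  intro n
  induction n with
  | zero =>
    refine ⟨fun i j _ ↦ by simp [vietaFibonacci_zero], fun i j h ↦ ?_⟩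
    have hij : i ≠ j := by rintro rfl; grind
    simp [vietaFibonacci_one, hij]
  | succ n ih =>
    refine ⟨ih.2, fun i j h ↦ ?_⟩
    have hr := vietaFibonacci_add_one A ((n + 1 : ℕ) : ℤ)
    rw [show ((n + 1 + 1 : ℕ) : ℤ) = ((n + 1 : ℕ) : ℤ) + 1 by push_cast; ring, hr, sub_apply,
      mul_apply, show ((n + 1 : ℕ) : ℤ) - 1 = n by push_cast; ring, ih.1 i j (by grind), sub_zero]
    refine Finset.sum_eq_zero fun l _ ↦ ?_
    by_cases hl : A l j = 0
    · simp [hl]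
    · rw [ih.2 i l (by have := hc l j hl; grind), zero_mul]

/-- The recurrence is invariant under reversing the index, so a zero of the sequence is a centre of
antisymmetry. Together with the centre at 0 this gives the period `2 * m`. -/
lemma vietaFibonacci_add_of_eq_zero {m : ℤ} (hm : A.vietaFibonacci m = 0) (n : ℤ) :
    A.vietaFibonacci (m + n) = -A.vietaFibonacci (m - n) := by
  suffices key : ∀ n : ℕ, A.vietaFibonacci (m + n) = -A.vietaFibonacci (m - n) ∧
      A.vietaFibonacci (m + (n + 1 : ℕ)) = -A.vietaFibonacci (m - (n + 1 : ℕ)) by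
    obtain ⟨k, rfl | rfl⟩ := n.eq_nat_or_neg
    · exact (key k).1
    · have := (key k).1
      simp only [sub_neg_eq_add, this, neg_neg, ← sub_eq_add_neg]
  intro n
  induction n with
  | zero =>
    have := vietaFibonacci_add_one A m
    simp_all
  | succ n ih =>
    refine ⟨ih.2, ?_⟩
    have h₁ := vietaFibonacci_add_one A (m + (n + 1 : ℕ))
    have h₂ := vietaFibonacci_add_one A (m - (n + 1 : ℕ))
    rw [show m + ((n + 1 : ℕ) : ℤ) - 1 = m + n by push_cast; ring, ih.1, ih.2] at h₁
    rw [show m - ((n + 1 : ℕ) : ℤ) + 1 = m - n by push_cast; ring] at h₂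
    rw [show m + ((n + 1 + 1 : ℕ) : ℤ) = m + (n + 1 : ℕ) + 1 by push_cast; ring,
      show m - ((n + 1 + 1 : ℕ) : ℤ) = m - (n + 1 : ℕ) - 1 by push_cast; ring, h₁, h₂, neg_mul]
    abel

lemma vietaFibonacci_add_two_mul {m : ℤ} (hm : A.vietaFibonacci m = 0) (n : ℤ) :
    A.vietaFibonacci (n + 2 * m) = A.vietaFibonacci n := by
  have h := vietaFibonacci_add_of_eq_zero hm (n + m)
  rw [show m - (n + m) = -n by ring, vietaFibonacci_neg, neg_neg] at h
  rw [← h]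
  ring_nf

end Matrix

/-! ### Positive roots and products of orthogonal simple reflections -/

namespace RootPairing.Base

section

variable {ι R M N : Type*} [Field R] [AddCommGroup M] [Module R M]
  [AddCommGroup N] [Module R N] {P : RootPairing ι R M N} (b : P.Base)

variable {b} in
lemma exists_eq_sum_smul_root_of_mem_closure {x : M}
    (hx : x ∈ AddSubmonoid.closure (P.root '' b.support)) :
    ∃ f : b.support → ℤ, 0 ≤ f ∧ x = ∑ j, f j • P.root j := by
  classical
  induction hx using AddSubmonoid.closure_induction with
  | mem x hx =>
    obtain ⟨j, hj, rfl⟩ := hx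
    refine ⟨Pi.single ⟨j, hj⟩ 1, by simp, ?_⟩
    rw [Finset.sum_eq_single ⟨j, hj⟩] <;> simp +contextual
  | zero => exact ⟨0, le_rfl, by simp⟩
  | add x y _ _ hx hy =>
    obtain ⟨f, hf, rfl⟩ := hx
    obtain ⟨g, hg, rfl⟩ := hy
    exact ⟨f + g, add_nonneg hf hg, by simp [add_smul, Finset.sum_add_distrib]⟩

section ReflectionProduct

variable {b}

variable {s : Finset b.support}
  (hs : (s : Set b.support).Pairwise (Function.onFun Commute fun i ↦ P.reflection i))

lemma noncommProd_reflection_mem_range {x : M} (hx : x ∈ Set.range P.root) :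
    s.noncommProd (fun i ↦ P.reflection i) hs x ∈ Set.range P.root := by
  revert x
  refine Finset.noncommProd_induction s _ hs (fun g : M ≃ₗ[R] M ↦ ∀ {x : M}, x ∈ Set.range P.root →
    g x ∈ Set.range P.root) (fun g g' h h' x hx ↦ h (h' hx)) (fun hx ↦ hx) ?_
  rintro i - _ ⟨φ, rfl⟩
  exact ⟨_, P.root_reflectionPerm i φ⟩

lemma noncommProd_reflection_apply
    (ho : ∀ i ∈ s, ∀ j ∈ s, i ≠ j → P.IsOrthogonal i j) (x : M) :
    s.noncommProd (fun i ↦ P.reflection i) hs x = x - ∑ i ∈ s, P.coroot' i x • P.root i := by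
  classical
  induction s using Finset.induction_on with
  | empty => simp
  | insert a s ha ih =>
    have h₁ : P.coroot' a (∑ i ∈ s, P.coroot' i x • P.root i) = 0 := by
      rw [map_sum]
      refine Finset.sum_eq_zero fun i hi ↦ ?_
      have hia : i ≠ a := by rintro rfl; exact ha hi
      rw [map_smul, P.root_coroot'_eq_pairing,
        (ho i (Finset.mem_insert_of_mem hi) a (Finset.mem_insert_self a s) hia).1, smul_zero]
    rw [Finset.noncommProd_insert_of_notMem _ _ _ _ ha, LinearEquiv.mul_apply,
      ih _ fun i hi j hj ↦ ho i (Finset.mem_insert_of_mem hi) j (Finset.mem_insert_of_mem hj),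
      P.reflection_apply, map_sub, h₁, Finset.sum_insert ha]
    simp only [sub_zero]
    abel

lemma noncommProd_reflection_simple_of_mem
    (ho : ∀ i ∈ s, ∀ j ∈ s, i ≠ j → P.IsOrthogonal i j) {i : b.support} (hi : i ∈ s) :
    s.noncommProd (fun i ↦ P.reflection i) hs (P.root i) = -P.root i := by
  rw [noncommProd_reflection_apply hs ho, Finset.sum_eq_single_of_mem i hi]
  · simp [two_smul]
  · intro j hj hji
    rw [P.root_coroot'_eq_pairing, (ho i hi j hj hji.symm).1, zero_smul]

end ReflectionProduct

variable [CharZero R]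

/-- The vector `x` is a positive root. -/
def IsPosRoot (x : M) : Prop :=
  ∃ φ, b.IsPos φ ∧ P.root φ = x

variable {b}

lemma isPosRoot_root {φ : ι} : b.IsPosRoot (P.root φ) ↔ b.IsPos φ :=
  ⟨fun ⟨_, h, h'⟩ ↦ P.root.injective h' ▸ h, fun h ↦ ⟨φ, h, rfl⟩⟩

lemma isPosRoot_simple (i : b.support) : b.IsPosRoot (P.root i) :=
  isPosRoot_root.2 (isPos_of_mem_support i.2)

lemma IsPosRoot.not_neg {x : M} (h : b.IsPosRoot x) : ¬ b.IsPosRoot (-x) := by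
  let := P.indexNeg
  obtain ⟨φ, hφ, rfl⟩ := h
  rw [← (by simp : P.root (-φ) = -P.root φ), isPosRoot_root, IsPos.neg_iff_not]
  simpa

lemma isPosRoot_or_neg (b : P.Base) {x : M} (hx : x ∈ Set.range P.root) :
    b.IsPosRoot x ∨ b.IsPosRoot (-x) := by
  let := P.indexNeg
  obtain ⟨φ, rfl⟩ := hx
  rw [← (by simp : P.root (-φ) = -P.root φ), isPosRoot_root, isPosRoot_root]
  exact IsPos.or_neg b φ

lemma IsPosRoot.mem_range {x : M} (h : b.IsPosRoot x) : x ∈ Set.range P.root := by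
  obtain ⟨φ, -, rfl⟩ := h
  exact ⟨φ, rfl⟩

lemma sum_smul_root_injective {f g : b.support → ℤ}
    (h : ∑ j, f j • P.root j = ∑ j, g j • P.root j) : f = g :=
  funext (Fintype.linearIndependent_iffₛ.mp (b.linearIndepOn_root.restrict_scalars' ℤ) f g h)

/-- Positivity is a condition on the height: if `-φ` were a nonnegative combination of simple roots,
the height of `φ` would be at most 0. -/
lemma IsPosRoot.exists_eq_sum {x : M} (hx : b.IsPosRoot x) :
    ∃ f : b.support → ℤ, 0 ≤ f ∧ x = ∑ j, f j • P.root j := by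
  classical
  obtain ⟨φ, hφ, rfl⟩ := hx
  refine exists_eq_sum_smul_root_of_mem_closure ((b.root_mem_or_neg_mem φ).resolve_right fun h ↦ ?_)
  obtain ⟨f, hf, hf'⟩ := exists_eq_sum_smul_root_of_mem_closure h
  have h₁ : P.root φ = ∑ j ∈ b.support, (fun j ↦ if hj : j ∈ b.support then -f ⟨j, hj⟩ else 0) j •
      P.root j := by
    rw [← neg_neg (P.root φ), hf', ← Finset.sum_neg_distrib, ← b.support.sum_coe_sort]
    simp
  have h₂ := height_eq_sum h₁
  rw [← b.support.sum_coe_sort] at h₂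
  have h₃ : b.height φ ≤ 0 := by
    rw [h₂]
    exact Finset.sum_nonpos fun j _ ↦ by simpa using hf j
  exact absurd (isPos_iff b |>.1 hφ) (by lia)

lemma IsPosRoot.nonneg {f : b.support → ℤ} (hf : b.IsPosRoot (∑ j, f j • P.root j)) : 0 ≤ f := by
  obtain ⟨g, hg, h⟩ := hf.exists_eq_sum
  rwa [sum_smul_root_injective h]

lemma IsPosRoot.of_nonneg {f : b.support → ℤ}
    (hf : ∑ j, f j • P.root j ∈ Set.range P.root) (h : 0 ≤ f) :
    b.IsPosRoot (∑ j, f j • P.root j) := by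
  refine (isPosRoot_or_neg b hf).resolve_right fun hn ↦ ?_
  have h₁ : 0 ≤ -f := IsPosRoot.nonneg (f := -f) (by simpa using hn)
  obtain rfl : f = 0 := le_antisymm (by simpa using h₁) h
  obtain ⟨φ, hφ⟩ := hf
  exact P.ne_zero φ (by simpa using hφ)

section ReflectionProduct

variable {s : Finset b.support}
  (hs : (s : Set b.support).Pairwise (Function.onFun Commute fun i ↦ P.reflection i))

lemma noncommProd_reflection_noncommProd_reflection
    (ho : ∀ i ∈ s, ∀ j ∈ s, i ≠ j → P.IsOrthogonal i j) (x : M) :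
    s.noncommProd (fun i ↦ P.reflection i) hs (s.noncommProd (fun i ↦ P.reflection i) hs x) = x := by
  have h := noncommProd_reflection_apply hs ho x
  have h' : s.noncommProd (fun i ↦ P.reflection i) hs (∑ i ∈ s, P.coroot' i x • P.root i) =
      -∑ i ∈ s, P.coroot' i x • P.root i := by
    rw [map_sum, ← Finset.sum_neg_distrib]
    exact Finset.sum_congr rfl fun i hi ↦ by
      rw [map_smul, noncommProd_reflection_simple_of_mem hs ho hi, smul_neg]
  rw [h, map_sub, h, h']
  abel

variable [Finite ι] [P.IsCrystallographic] [P.IsReduced]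

/-- A simple reflection makes only its own simple root negative. If a partial product sends `x` to
`α_a`, then, being an involution that fixes the orthogonal root `α_a`, it shows `x = α_a`. -/
lemma IsPosRoot.noncommProd_reflection {x : M} (hx : b.IsPosRoot x) (hxs : ∀ i ∈ s, x ≠ P.root i)
    (ho : ∀ i ∈ s, ∀ j ∈ s, i ≠ j → P.IsOrthogonal i j) :
    b.IsPosRoot (s.noncommProd (fun i ↦ P.reflection i) hs x) := by
  classical
  induction s using Finset.induction_on with
  | empty => simpa
  | insert a s ha ih =>
    have ho' : ∀ i ∈ s, ∀ j ∈ s, i ≠ j → P.IsOrthogonal i j :=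
      fun i hi j hj ↦ ho i (Finset.mem_insert_of_mem hi) j (Finset.mem_insert_of_mem hj)
    have hs' := hs.mono (fun _ hi ↦ Finset.mem_insert_of_mem hi : (s : Set b.support) ⊆ _)
    obtain ⟨φ, hφ, hφx⟩ := ih hs' (fun i hi ↦ hxs i (Finset.mem_insert_of_mem hi)) ho'
    rw [Finset.noncommProd_insert_of_notMem _ _ _ _ ha, LinearEquiv.mul_apply, ← hφx,
      ← P.root_reflectionPerm, isPosRoot_root]
    refine hφ.reflectionPerm a.2 ?_
    rintro rfl
    refine hxs a (Finset.mem_insert_self a s) ?_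
    rw [← noncommProd_reflection_noncommProd_reflection hs' ho' x, ← hφx,
      noncommProd_reflection_apply hs' ho', Finset.sum_eq_zero, sub_zero]
    intro i hi
    have hia : a ≠ i := by rintro rfl; exact ha hi
    rw [P.root_coroot'_eq_pairing,
      (ho a (Finset.mem_insert_self a s) i (Finset.mem_insert_of_mem hi) hia).1, zero_smul]

end ReflectionProduct

end

end RootPairing.Base

/-! ### Zigzags and the action of the two halves of the Coxeter element -/

namespace RootPairing.Base

section

open scoped Classical

variable {ι R M N : Type*} [Field R] [CharZero R] [AddCommGroup M] [Module R M]
  [AddCommGroup N] [Module R N] {P : RootPairing ι R M N} [P.IsCrystallographic]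

/-- The matrix `2 - C`, where `C` is the Cartan matrix: in the simply laced case, the adjacency
matrix of the Dynkin diagram. -/
noncomputable def adjacency (b : P.Base) : Matrix b.support b.support ℤ :=
  Matrix.of fun i j ↦ if i = j then 0 else -b.cartanMatrix i j

/-- The vectors obtained from `-α_i` (for `n = 0`) and `α_i` (for `n = 1`) by alternate application
of the two halves of a bipartite Coxeter element. -/
noncomputable def zigzag (b : P.Base) (n : ℤ) (i : b.support) : M :=
  ∑ j, (b.adjacency.vietaFibonacci n + b.adjacency.vietaFibonacci (n - 1)) i j • P.root j

variable {b : P.Base}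

lemma zigzag_one (i : b.support) : b.zigzag 1 i = P.root i := by
  simp [zigzag, Matrix.vietaFibonacci_one, Matrix.vietaFibonacci_zero, Matrix.one_apply]

lemma zigzag_one_sub (n : ℤ) (i : b.support) : b.zigzag (1 - n) i = -b.zigzag n i := by
  rw [zigzag, zigzag, ← Finset.sum_neg_distrib]
  refine Finset.sum_congr rfl fun j _ ↦ ?_
  rw [← neg_sub n 1, show -(n - 1) - 1 = -n by ring, Matrix.vietaFibonacci_neg,
    Matrix.vietaFibonacci_neg, ← neg_smul]
  simp only [Matrix.add_apply, Matrix.neg_apply]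
  ring_nf

lemma zigzag_zero (i : b.support) : b.zigzag 0 i = -P.root i := by
  simpa [zigzag_one] using zigzag_one_sub 1 i

lemma adjacency_nonneg [Finite ι] (i j : b.support) : 0 ≤ b.adjacency i j := by
  rw [adjacency, Matrix.of_apply]
  split_ifs with h
  · rfl
  · simpa using b.cartanMatrix_le_zero_of_ne i j h

lemma adjacency_ne_zero_iff {i j : b.support} :
    b.adjacency i j ≠ 0 ↔ i ≠ j ∧ b.cartanMatrix i j ≠ 0 := by
  simp [adjacency]

lemma pairing_simple_eq (i j : b.support) :
    P.pairing i j = (((if i = j then 2 else 0) - b.adjacency i j : ℤ) : R) := by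
  have h := b.algebraMap_cartanMatrixIn_apply ℤ i j
  rw [← h, adjacency, Matrix.of_apply]
  split_ifs with hij
  · subst hij
    simp
  · simp

lemma coroot'_sum_smul_root (f : b.support → ℤ) (j : b.support) :
    P.coroot' j (∑ l, f l • P.root l) = ((2 * f j - (Matrix.vecMul f b.adjacency) j : ℤ) : R) := by
  simp only [map_sum, map_zsmul, P.root_coroot'_eq_pairing, pairing_simple_eq, zsmul_eq_mul,
    Matrix.vecMul, dotProduct]
  push_cast
  simp only [mul_sub, Finset.sum_sub_distrib, mul_ite, mul_zero, Finset.sum_ite_eq',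
    Finset.mem_univ, if_true]
  ring

lemma coroot'_zigzag (n : ℤ) (i j : b.support) :
    P.coroot' j (b.zigzag n i) =
      ((b.adjacency.vietaFibonacci n + b.adjacency.vietaFibonacci (n - 1)
        - b.adjacency.vietaFibonacci (n + 1) - b.adjacency.vietaFibonacci (n - 2)) i j : ℤ) := by
  have h₁ := Matrix.vietaFibonacci_add_one b.adjacency n
  have h₂ := Matrix.vietaFibonacci_add_one b.adjacency (n - 1)
  rw [sub_add_cancel, sub_sub, one_add_one_eq_two] at h₂
  have h₃ : Matrix.vecMul (fun l ↦ (b.adjacency.vietaFibonacci n +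
      b.adjacency.vietaFibonacci (n - 1)) i l) b.adjacency j =
        (b.adjacency.vietaFibonacci (n + 1) + b.adjacency.vietaFibonacci (n - 1) +
          (b.adjacency.vietaFibonacci n + b.adjacency.vietaFibonacci (n - 2))) i j := by
    rw [h₁, sub_add_cancel]
    nth_rw 3 [h₂]
    rw [sub_add_cancel, ← add_mul]
    rfl
  rw [zigzag, coroot'_sum_smul_root, h₃]
  congr 1
  simp only [Matrix.add_apply, Matrix.sub_apply]
  ring

namespace Bipartition

variable {ψ : ι} (S : b.Bipartition ψ)

/-- The colour of a simple root: `1` on the first part and `0` on the second part. -/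
noncomputable def color (i : b.support) : ℤ :=
  if i ∈ S.I₁ then 1 else 0

variable {S}

lemma color_of_mem₁ {i : b.support} (hi : i ∈ S.I₁) : S.color i = 1 := by
  simp [color, hi]

lemma notMem₁ {i : b.support} (hi : i ∈ S.I₂) : i ∉ S.I₁ :=
  fun h ↦ Finset.disjoint_left.1 S.disjoint h hi

lemma color_of_mem₂ {i : b.support} (hi : i ∈ S.I₂) : S.color i = 0 := by
  simp [color, notMem₁ hi]

lemma β_of_mem₁ {i : b.support} (hi : i ∈ S.I₁) : S.β i = P.root i := by
  simp [β, hi]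

lemma β_of_mem₂ {i : b.support} (hi : i ∈ S.I₂) : S.β i = -P.root i := by
  simp [β, notMem₁ hi]

lemma β_eq_zigzag (i : b.support) : S.β i = b.zigzag (S.color i) i := by
  rcases S.mem_or_mem i with hi | hi
  · rw [β_of_mem₁ hi, color_of_mem₁ hi, zigzag_one]
  · rw [β_of_mem₂ hi, color_of_mem₂ hi, zigzag_zero]

lemma odd_color_add_color {i j : b.support} (h : b.adjacency i j ≠ 0) :
    Odd (S.color i + S.color j) := by
  obtain ⟨hij, hc⟩ := adjacency_ne_zero_iff.1 h
  rw [ne_eq, cartanMatrix_apply_eq_zero_iff_pairing] at hc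
  rcases S.mem_or_mem i with hi | hi <;> rcases S.mem_or_mem j with hj | hj
  · exact absurd (S.orthogonal₁ i hi j hj hij).1 hc
  · simp [color_of_mem₁ hi, color_of_mem₂ hj]
  · simp [color_of_mem₂ hi, color_of_mem₁ hj]
  · exact absurd (S.orthogonal₂ i hi j hj hij).1 hc

variable (S) in
lemma vietaFibonacci_adjacency_apply_eq_zero {n : ℤ} {i j : b.support}
    (h : Even (n + S.color i + S.color j)) : b.adjacency.vietaFibonacci n i j = 0 :=
  Matrix.vietaFibonacci_apply_eq_zero (c := S.color) (fun _ _ ↦ odd_color_add_color) h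

lemma τ₁_apply (x : M) : S.τ₁ x = x - ∑ i ∈ S.I₁, P.coroot' i x • P.root i :=
  noncommProd_reflection_apply _ S.orthogonal₁ x

lemma τ₂_apply (x : M) : S.τ₂ x = x - ∑ i ∈ S.I₂, P.coroot' i x • P.root i :=
  noncommProd_reflection_apply _ S.orthogonal₂ x

@[simp] lemma τ₁_τ₁ (x : M) : S.τ₁ (S.τ₁ x) = x :=
  noncommProd_reflection_noncommProd_reflection _ S.orthogonal₁ x

@[simp] lemma τ₂_τ₂ (x : M) : S.τ₂ (S.τ₂ x) = x :=
  noncommProd_reflection_noncommProd_reflection _ S.orthogonal₂ x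

lemma τ₁_mem_range {x : M} (hx : x ∈ Set.range P.root) : S.τ₁ x ∈ Set.range P.root :=
  noncommProd_reflection_mem_range _ hx

lemma τ₂_mem_range {x : M} (hx : x ∈ Set.range P.root) : S.τ₂ x ∈ Set.range P.root :=
  noncommProd_reflection_mem_range _ hx

/-- In the applications `s` is one part of the partition and both sides of each hypothesis vanish by
parity. Keeping them as equalities lets one computation serve `τ₁` and `τ₂`. -/
lemma sub_sum_coroot'_zigzag (s : Finset b.support) (n : ℤ) (i : b.support)

    (hs : ∀ j ∈ s, b.adjacency.vietaFibonacci (n + 1) i j = b.adjacency.vietaFibonacci (n - 1) i j)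
    (hs' : ∀ j, j ∉ s → b.adjacency.vietaFibonacci n i j = b.adjacency.vietaFibonacci (n - 2) i j) :
    b.zigzag n i - ∑ j ∈ s, P.coroot' j (b.zigzag n i) • P.root j = b.zigzag (n - 1) i := by
  have h (j : b.support) (z : ℤ) : (z : R) • P.root j = z • P.root j := Int.cast_smul_eq_zsmul R z _
  simp_rw [coroot'_zigzag, h]
  rw [zigzag, zigzag, sub_eq_iff_eq_add, ← Finset.sum_filter_add_sum_filter_not _ (· ∈ s),
    Finset.filter_univ_mem, ← Finset.sum_filter_add_sum_filter_not (Finset.univ : Finset b.support)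
    (· ∈ s), Finset.filter_univ_mem, add_right_comm, ← Finset.sum_add_distrib]
  congr 1
  · refine Finset.sum_congr rfl fun j hj ↦ ?_
    rw [← add_smul]
    congr 1
    have := hs j hj
    simp only [Matrix.add_apply, Matrix.sub_apply, sub_sub, one_add_one_eq_two]
    linarith
  · refine Finset.sum_congr rfl fun j hj ↦ ?_
    congr 1
    have := hs' j (by simpa using hj)
    simp only [Matrix.add_apply, sub_sub, one_add_one_eq_two]
    linarith

/-- The parity of `n + S.color i` decides which half lowers the index; the other half raises it. -/
lemma τ₁_zigzag {n : ℤ} {i : b.support} (h : Even (n + S.color i)) :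
    S.τ₁ (b.zigzag n i) = b.zigzag (n - 1) i := by
  rw [τ₁_apply]
  refine sub_sum_coroot'_zigzag S.I₁ n i (fun j hj ↦ ?_) (fun j hj ↦ ?_)
  · have := color_of_mem₁ hj
    rw [S.vietaFibonacci_adjacency_apply_eq_zero (by grind),
      S.vietaFibonacci_adjacency_apply_eq_zero (by grind)]
  · have := color_of_mem₂ ((S.mem_or_mem j).resolve_left hj)
    rw [S.vietaFibonacci_adjacency_apply_eq_zero (by grind),
      S.vietaFibonacci_adjacency_apply_eq_zero (by grind)]

lemma τ₂_zigzag {n : ℤ} {i : b.support} (h : Odd (n + S.color i)) :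
    S.τ₂ (b.zigzag n i) = b.zigzag (n - 1) i := by
  rw [τ₂_apply]
  refine sub_sum_coroot'_zigzag S.I₂ n i (fun j hj ↦ ?_) (fun j hj ↦ ?_)
  · have := color_of_mem₂ hj
    rw [S.vietaFibonacci_adjacency_apply_eq_zero (by grind),
      S.vietaFibonacci_adjacency_apply_eq_zero (by grind)]
  · have := color_of_mem₁ ((S.mem_or_mem j).resolve_right hj)
    rw [S.vietaFibonacci_adjacency_apply_eq_zero (by grind),
      S.vietaFibonacci_adjacency_apply_eq_zero (by grind)]

lemma τ₁_zigzag' {n : ℤ} {i : b.support} (h : Odd (n + S.color i)) :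
    S.τ₁ (b.zigzag n i) = b.zigzag (n + 1) i := by
  have := τ₁_zigzag (S := S) (n := n + 1) (i := i) (by grind)
  rw [add_sub_cancel_right] at this
  rw [← this, τ₁_τ₁]

lemma τ₂_zigzag' {n : ℤ} {i : b.support} (h : Even (n + S.color i)) :
    S.τ₂ (b.zigzag n i) = b.zigzag (n + 1) i := by
  have := τ₂_zigzag (S := S) (n := n + 1) (i := i) (by grind)
  rw [add_sub_cancel_right] at this
  rw [← this, τ₂_τ₂]

lemma σ_apply (x : M) : S.σ x = S.τ₂ (S.τ₁ x) := rfl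

lemma σ_zigzag {n : ℤ} {i : b.support} (h : Even (n + S.color i)) :
    S.σ (b.zigzag n i) = b.zigzag (n - 2) i := by
  rw [σ_apply, τ₁_zigzag h, τ₂_zigzag (by grind), sub_sub, one_add_one_eq_two]

lemma σ_zpow_zigzag {n : ℤ} {i : b.support} (h : Even (n + S.color i)) (m : ℤ) :
    (S.σ ^ m) (b.zigzag n i) = b.zigzag (n - 2 * m) i := by
  induction m using Int.induction_on with
  | zero => simp
  | succ m ih =>
    rw [add_comm, zpow_one_add, LinearEquiv.mul_apply, ih, σ_zigzag (by grind)]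
    ring_nf
  | pred m ih =>
    apply S.σ.injective
    rw [← LinearEquiv.mul_apply, ← zpow_one_add, add_sub_cancel, ih, σ_zigzag (by grind)]
    ring_nf

lemma zigzag_mem_range (S : b.Bipartition ψ) (n : ℤ) (i : b.support) : b.zigzag n i ∈ Set.range P.root := by
  suffices key : ∀ n : ℕ, b.zigzag (n + 1) i ∈ Set.range P.root by
    rcases le_or_gt 1 n with hn | hn
    · have h := key (n - 1).toNat
      rwa [Int.toNat_of_nonneg (by lia), sub_add_cancel] at h
    · have h := key (-n).toNat
      rw [Int.toNat_of_nonneg (by lia), neg_add_eq_sub, zigzag_one_sub] at h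
      exact P.neg_mem_range_root_iff.1 h
  intro n
  induction n with
  | zero => simp [zigzag_one]
  | succ n ih =>
    push_cast
    rcases Int.even_or_odd (n + 1 + S.color i) with h | h
    · exact τ₂_zigzag' h ▸ S.τ₂_mem_range ih
    · exact τ₁_zigzag' h ▸ S.τ₁_mem_range ih

/-- A coincidence between two members of a zigzag propagates along it. -/
lemma zigzag_eq_shift (S : b.Bipartition ψ) {i : b.support} {m n : ℤ} (hmn : Even (n - m))
    (h : b.zigzag m i = b.zigzag n i) (k : ℤ) : b.zigzag (m + k) i = b.zigzag (n + k) i := by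
  induction k using Int.induction_on with
  | zero => simpa
  | succ k ih =>
    rw [← add_assoc, ← add_assoc]
    rcases Int.even_or_odd (m + k + S.color i) with h | h
    · rw [← τ₂_zigzag' h, ih, τ₂_zigzag' (by grind)]
    · rw [← τ₁_zigzag' h, ih, τ₁_zigzag' (by grind)]
  | pred k ih =>
    rw [← add_sub_assoc, ← add_sub_assoc]
    rcases Int.even_or_odd (m + -k + S.color i) with h | h
    · rw [← τ₁_zigzag h, ih, τ₁_zigzag (by grind)]
    · rw [← τ₂_zigzag h, ih, τ₂_zigzag (by grind)]

end Bipartition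

end

end RootPairing.Base

/-! ### The half-period of the zigzags -/

namespace RootPairing.Base

section

open scoped Classical

variable {ι R M N : Type*} [Field R] [CharZero R] [AddCommGroup M] [Module R M]
  [AddCommGroup N] [Module R N] {P : RootPairing ι R M N} [P.IsCrystallographic]

/-- The Dynkin diagram is connected. -/
def IsConnected (b : P.Base) : Prop :=
  ∀ X : Set b.support, X.Nonempty → (∀ i ∈ X, ∀ j, b.adjacency i j ≠ 0 → j ∈ X) → ∀ i, i ∈ X

/-- `H` is a half-period of the zigzags of `b`, on which they are positive. -/
structure IsHalfPeriod (b : P.Base) (H : ℕ) : Prop where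
  pos : 0 < H
  vietaFibonacci_eq_zero : b.adjacency.vietaFibonacci H = 0
  isPosRoot : ∀ n : ℤ, 1 ≤ n → n ≤ H → ∀ i, b.IsPosRoot (b.zigzag n i)

variable {b : P.Base}

namespace Bipartition

variable {ψ : ι} {S : b.Bipartition ψ}

lemma exists_not_isPosRoot_zigzag [Finite ι] (S : b.Bipartition ψ) (i : b.support) :
    ∃ n : ℕ, ∃ i, ¬ b.IsPosRoot (b.zigzag (n + 1) i) := by
  by_contra! hc
  choose f hf using fun k : ℕ ↦ S.zigzag_mem_range (2 * k) i
  obtain ⟨k, l, hkl, hne⟩ : ∃ k l, f k = f l ∧ k < l := by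
    obtain ⟨k, l, hne, h⟩ := Finite.exists_ne_map_eq_of_infinite f
    rcases lt_or_gt_of_ne hne with h' | h'
    exacts [⟨k, l, h, h'⟩, ⟨l, k, h.symm, h'⟩]
  -- Shifting the coincidence back to index 0 makes `-α_i` equal to a zigzag of positive index.
  have h := S.zigzag_eq_shift (i := i) (m := 2 * k) (n := 2 * l) (by grind)
    (by rw [← hf, ← hf, hkl]) (-(2 * k))
  have h' := hc (2 * l - 2 * k - 1) i
  rw [show ((2 * l - 2 * k - 1 : ℕ) : ℤ) + 1 = 2 * l + -(2 * k) by lia, ← h, add_neg_cancel,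
    zigzag_zero] at h'
  exact (isPosRoot_simple i).not_neg h'

lemma exists_isHalfPeriod [Finite ι] (S : b.Bipartition ψ) (hconn : b.IsConnected)
    (i : b.support) : ∃ H : ℕ, b.IsHalfPeriod H := by
  have hex := S.exists_not_isPosRoot_zigzag i
  let H := Nat.find hex
  obtain ⟨i₀, hi₀⟩ := Nat.find_spec hex
  have hpos (n : ℤ) (h₁ : 1 ≤ n) (h₂ : n ≤ H) (i) : b.IsPosRoot (b.zigzag n i) := by
    have := Nat.find_min hex (m := (n - 1).toNat) (by lia)
    push Not at this
    have h := this i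
    rwa [show ((n - 1).toNat : ℤ) + 1 = n by lia] at h
  have hH : (1 : ℤ) ≤ H := by
    by_contra h
    refine hi₀ ?_
    rw [show ((Nat.find hex : ℕ) : ℤ) = 0 by lia, zero_add, zigzag_one]
    exact isPosRoot_simple i₀
  -- Where the entry of index `H` can be nonzero, the entry of index `H - 1` vanishes by parity, so
  -- it is a coefficient of a positive root.
  have hnn (i j) : 0 ≤ b.adjacency.vietaFibonacci H i j := by
    rcases Int.even_or_odd (H + S.color i + S.color j) with h | h
    · rw [S.vietaFibonacci_adjacency_apply_eq_zero h]
    · have := (hpos H hH le_rfl i).nonneg j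
      rwa [Matrix.add_apply, S.vietaFibonacci_adjacency_apply_eq_zero (n := (H : ℤ) - 1) (by grind),
        add_zero] at this
  refine ⟨H, by lia, ?_, hpos⟩
  suffices ∀ i, i ∈ {i | ∀ j, b.adjacency.vietaFibonacci H i j = 0} by
    ext i j
    exact this i j
  -- Row `i₀` vanishes because `-zigzag (H + 1) i₀` is positive, which gives the opposite
  -- inequality. Zero rows then spread to neighbours: `A` commutes with the polynomial, so a zero
  -- row `i` is a sum of nonnegative terms.
  refine hconn _ ⟨i₀, fun j ↦ le_antisymm ?_ (hnn i₀ j)⟩ fun i hi j hij l ↦ ?_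
  · rcases Int.even_or_odd (H + S.color i₀ + S.color j) with h | h
    · rw [S.vietaFibonacci_adjacency_apply_eq_zero h]
    · have h' := ((isPosRoot_or_neg b (S.zigzag_mem_range (H + 1) i₀)).resolve_left hi₀)
      rw [← zigzag_one_sub] at h'
      have := h'.nonneg j
      rw [Matrix.add_apply, show (1 : ℤ) - (H + 1) = -H by ring, Matrix.vietaFibonacci_neg,
        S.vietaFibonacci_adjacency_apply_eq_zero (n := -(H : ℤ) - 1) (by grind), add_zero,
        Matrix.neg_apply] at this
      simpa using this
  · have h : (b.adjacency * b.adjacency.vietaFibonacci H) i l = 0 := by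
      rw [← Matrix.vietaFibonacci_mul_comm, Matrix.mul_apply]
      exact Finset.sum_eq_zero fun j _ ↦ by rw [hi j, zero_mul]
    rw [Matrix.mul_apply, Finset.sum_eq_zero_iff_of_nonneg
      fun j _ ↦ mul_nonneg (adjacency_nonneg i j) (hnn j l)] at h
    exact (mul_eq_zero.1 (h j (Finset.mem_univ j))).resolve_left hij

end Bipartition

namespace IsHalfPeriod

variable {H : ℕ} (hH : b.IsHalfPeriod H)
include hH

lemma zigzag_add (n : ℤ) (i : b.support) : b.zigzag (n + 2 * H) i = b.zigzag n i := by
  rw [zigzag, zigzag, Matrix.vietaFibonacci_add_two_mul hH.vietaFibonacci_eq_zero,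
    add_sub_right_comm, Matrix.vietaFibonacci_add_two_mul hH.vietaFibonacci_eq_zero]

lemma zigzag_add_mul (n k : ℤ) (i : b.support) :
    b.zigzag (n + 2 * (H * k)) i = b.zigzag n i := by
  induction k using Int.induction_on with
  | zero => simp
  | succ k ih => rw [← ih, ← hH.zigzag_add (n + 2 * (H * k))]; ring_nf
  | pred k ih => rw [← ih, ← hH.zigzag_add (n + 2 * (H * (-k - 1)))]; ring_nf

lemma isPosRoot_neg_zigzag {n : ℤ} (h₁ : 1 - H ≤ n) (h₂ : n ≤ 0) (i : b.support) :
    b.IsPosRoot (-b.zigzag n i) := by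
  rw [← zigzag_one_sub]
  exact hH.isPosRoot _ (by lia) (by lia) i

end IsHalfPeriod

end

end RootPairing.Base

/-! ### Orbits of the Coxeter element and the integer attached to a positive root -/

namespace RootPairing.Base

section

open scoped Classical

variable {ι R M N : Type*} [Field R] [CharZero R] [AddCommGroup M] [Module R M]
  [AddCommGroup N] [Module R N] {P : RootPairing ι R M N} [P.IsCrystallographic]
  {b : P.Base} {ψ : ι}

namespace Bipartition

/-- The alternating product `⋯ τ₁ τ₂ τ₁` with `n` factors. -/
noncomputable def halfSteps (S : b.Bipartition ψ) : ℕ → M ≃ₗ[R] M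
  | 0 => 1
  | n + 1 => (if Even n then S.τ₁ else S.τ₂) * S.halfSteps n

variable {S : b.Bipartition ψ}

lemma mem_orbit_iff {x y : M} : x ∈ S.orbit y ↔ ∃ k : ℤ, (S.σ ^ k) y = x := by
  constructor
  · rintro ⟨⟨-, k, rfl⟩, h⟩
    exact ⟨k, h⟩
  · rintro ⟨k, h⟩
    exact ⟨⟨S.σ ^ k, k, rfl⟩, h⟩

lemma orbit_eq_of_mem {x y : M} (h : x ∈ S.orbit y) : S.orbit x = S.orbit y :=
  MulAction.orbit_eq_iff.2 h

lemma mem_orbit_comm {x y : M} : x ∈ S.orbit y ↔ y ∈ S.orbit x :=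
  MulAction.mem_orbit_symm

lemma even_color_add_color (i : b.support) : Even (S.color i + S.color i) := ⟨_, rfl⟩

lemma mem_orbit_β_iff {x : M} {i : b.support} :
    x ∈ S.orbit (S.β i) ↔ ∃ k : ℤ, b.zigzag (S.color i + 2 * k) i = x := by
  simp_rw [mem_orbit_iff, β_eq_zigzag, σ_zpow_zigzag (even_color_add_color i)]
  exact ⟨fun ⟨k, h⟩ ↦ ⟨-k, by rw [← h]; ring_nf⟩, fun ⟨k, h⟩ ↦ ⟨-k, by rw [← h]; ring_nf⟩⟩

lemma halfSteps_two_mul (m : ℕ) : S.halfSteps (2 * m) = S.σ ^ m := by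
  induction m with
  | zero => rfl
  | succ m ih =>
    rw [mul_add, mul_one, halfSteps, halfSteps, if_pos (even_two_mul m), if_neg (by grind), ih,
      pow_succ', ← mul_assoc]
    rfl

lemma halfSteps_mem_range (n : ℕ) {x : M} (hx : x ∈ Set.range P.root) :
    S.halfSteps n x ∈ Set.range P.root := by
  induction n with
  | zero => exact hx
  | succ n ih =>
    rw [halfSteps, LinearEquiv.mul_apply]
    split_ifs
    exacts [τ₁_mem_range ih, τ₂_mem_range ih]

lemma halfSteps_β (n : ℕ) (i : b.support) :
    S.halfSteps n (S.β i) = b.zigzag (S.color i - n) i := by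
  induction n with
  | zero => simp [halfSteps, β_eq_zigzag]
  | succ n ih =>
    rw [halfSteps, LinearEquiv.mul_apply, ih, Nat.cast_succ, ← sub_sub]
    split_ifs
    · exact τ₁_zigzag (by grind)
    · exact τ₂_zigzag (by grind)

lemma τ₁_simple {i : b.support} (hi : i ∈ S.I₁) : S.τ₁ (P.root i) = -P.root i :=
  noncommProd_reflection_simple_of_mem _ S.orthogonal₁ hi

lemma τ₂_simple {i : b.support} (hi : i ∈ S.I₂) : S.τ₂ (P.root i) = -P.root i :=
  noncommProd_reflection_simple_of_mem _ S.orthogonal₂ hi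

variable {H : ℕ}

/-- The roots `β_i` lie in distinct orbits of the Coxeter element. -/
lemma eq_of_β_mem_orbit (hH : b.IsHalfPeriod H) {i j : b.support} (h : S.β j ∈ S.orbit (S.β i)) :
    j = i := by
  have hHpos := hH.pos
  -- The index is reduced modulo the period `2H` into `[1 - H, H]`, where the sign of the zigzag is
  -- known.
  obtain ⟨n, hn₁, hn₂, hn, hpar⟩ : ∃ n : ℤ, 1 - H ≤ n ∧ n ≤ H ∧ b.zigzag n i = S.β j ∧
      Even (n + S.color i) := by
    obtain ⟨k, hk⟩ := mem_orbit_β_iff.1 h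
    let m := S.color i + 2 * k - (1 - H)
    have h₁ := Int.emod_add_mul_ediv m (2 * H)
    have h₂ := Int.emod_nonneg m (b := 2 * H) (by lia)
    have h₃ := Int.emod_lt_of_pos m (b := 2 * H) (by lia)
    refine ⟨m % (2 * H) + (1 - H), by lia, by lia, ?_, ?_⟩
    · rw [← hk, ← hH.zigzag_add_mul _ (m / (2 * H))]
      congr 1
      lia
    · have : m % (2 * H) = m - 2 * (H * (m / (2 * H))) := by lia
      rw [this]
      exact ⟨S.color i + k - H * (m / (2 * H)), by ring⟩
  have hinj {i j : b.support} (h : P.root i = P.root j) : i = j :=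
    Subtype.ext (P.root.injective h)
  rcases S.mem_or_mem j with hj | hj
  · rw [β_of_mem₁ hj] at hn
    have h₁ : 1 ≤ n := by
      by_contra! h₁
      exact (isPosRoot_simple j).not_neg (hn ▸ hH.isPosRoot_neg_zigzag hn₁ (by lia) i)
    -- If `n > 1`, then `τ₁` leads to another positive zigzag, whereas it sends `α_j` to `-α_j`.
    have h₂ : n ≤ 1 := by
      by_contra! h₂
      have h₃ := hH.isPosRoot (n - 1) (by lia) (by lia) i
      rw [← τ₁_zigzag hpar, hn, τ₁_simple hj] at h₃
      exact (isPosRoot_simple j).not_neg h₃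
    obtain rfl : n = 1 := le_antisymm h₂ h₁
    rw [zigzag_one] at hn
    exact hinj hn.symm
  · rw [β_of_mem₂ hj] at hn
    have h₁ : n ≤ 0 := by
      by_contra! h₁
      exact (isPosRoot_simple j).not_neg (hn ▸ hH.isPosRoot n (by lia) hn₂ i)
    have h₂ : 0 ≤ n := by
      by_contra! h₂
      have h₃ := hH.isPosRoot_neg_zigzag (n := n + 1) (by lia) (by lia) i
      rw [← τ₂_zigzag' hpar, hn, map_neg, τ₂_simple hj, neg_neg] at h₃
      exact (isPosRoot_simple j).not_neg h₃
    obtain rfl : n = 0 := le_antisymm h₁ h₂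
    rw [zigzag_zero] at hn
    exact hinj (neg_injective hn.symm)

/-- A coincidence at distance at most `H` is shifted to index 0, a longer one to index 1. Each time
a simple root would have the wrong sign, after subtracting a period in the second case. -/
lemma zigzag_ne (hH : b.IsHalfPeriod H) (S : b.Bipartition ψ) {m n : ℤ} (hmn : Even (n - m))
    (h₁ : m < n) (h₂ : n < m + 2 * H) (i : b.support) : b.zigzag m i ≠ b.zigzag n i := by
  intro h
  rcases le_or_gt (n - m) H with h₃ | h₃
  · have h₀ := S.zigzag_eq_shift hmn h (-m)
    rw [add_neg_cancel, ← sub_eq_add_neg, zigzag_zero] at h₀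
    exact (isPosRoot_simple i).not_neg (h₀ ▸ hH.isPosRoot (n - m) (by lia) h₃ i)
  · have h₀ := S.zigzag_eq_shift hmn h (1 - m)
    have h₄ := hH.isPosRoot_neg_zigzag (n := n + (1 - m) - 2 * H) (by lia) (by lia) i
    rw [← hH.zigzag_add, sub_add_cancel, ← h₀, add_sub_cancel, zigzag_one] at h₄
    exact (isPosRoot_simple i).not_neg h₄

/-- `H` half-steps act like the longest element of the Weyl group: `α_i` lands on `zigzag (1 - H)
i`, directly for `i ∈ I₁` and up to one period for `i ∈ I₂`. -/
lemma isPosRoot_neg_halfSteps_simple (hH : b.IsHalfPeriod H) (i : b.support) :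
    b.IsPosRoot (-S.halfSteps H (P.root i)) := by
  rcases S.mem_or_mem i with hi | hi
  · rw [← S.β_of_mem₁ hi, halfSteps_β, color_of_mem₁ hi]
    exact hH.isPosRoot_neg_zigzag le_rfl (by have := hH.pos; lia) i
  · rw [← neg_neg (P.root i), ← S.β_of_mem₂ hi, map_neg, halfSteps_β, color_of_mem₂ hi,
      ← zigzag_one_sub, show (1 : ℤ) - (0 - H) = (1 - H) + 2 * H by ring, hH.zigzag_add]
    exact hH.isPosRoot_neg_zigzag le_rfl (by have := hH.pos; lia) i

lemma isPosRoot_neg_halfSteps (hH : b.IsHalfPeriod H) {x : M} (hx : b.IsPosRoot x) :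
    b.IsPosRoot (-S.halfSteps H x) := by
  choose f hf₀ hf using fun i ↦ (isPosRoot_neg_halfSteps_simple (S := S) hH i).exists_eq_sum
  obtain ⟨g, hg₀, hg⟩ := hx.exists_eq_sum
  have h : -S.halfSteps H x = ∑ j, (∑ i, g i • f i) j • P.root j := by
    simp only [Finset.sum_apply, Pi.smul_apply, Finset.sum_smul, smul_assoc]
    rw [Finset.sum_comm]
    simp only [← Finset.smul_sum, ← hf, smul_neg, Finset.sum_neg_distrib]
    rw [hg, map_sum]
    simp only [map_zsmul]
  have hr : -S.halfSteps H x ∈ Set.range P.root :=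
    P.neg_mem_range_root_iff.2 (halfSteps_mem_range H hx.mem_range)
  rw [h] at hr ⊢
  exact .of_nonneg hr (Finset.sum_nonneg fun i _ ↦ smul_nonneg (hg₀ i) (hf₀ i))

variable [Finite ι] [P.IsReduced]

lemma isPosRoot_τ₁ {x : M} (hx : b.IsPosRoot x) (h : ∀ i ∈ S.I₁, x ≠ P.root i) :
    b.IsPosRoot (S.τ₁ x) :=
  hx.noncommProd_reflection _ h S.orthogonal₁

lemma isPosRoot_τ₂ {x : M} (hx : b.IsPosRoot x) (h : ∀ i ∈ S.I₂, x ≠ P.root i) :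
    b.IsPosRoot (S.τ₂ x) :=
  hx.noncommProd_reflection _ h S.orthogonal₂

lemma k_of_mem₁ {i : b.support} (hi : i ∈ S.I₁) : S.k i = 1 := by
  simp [k, hi]

lemma k_of_mem₂ {i : b.support} (hi : i ∈ S.I₂) : S.k i = 2 := by
  simp [k, notMem₁ hi]

/-- The simple root at which the trajectory of a positive root becomes negative. -/
lemma exists_σ_pow_eq_β (hH : b.IsHalfPeriod H) {x : M} (hx : b.IsPosRoot x) :
    ∃ n i, 1 ≤ n ∧ n ≤ H ∧ n ≡ S.k i [MOD 2] ∧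
      (S.k i = 1 → (S.σ ^ ((n - 1) / 2)) x = S.β i) ∧
      (S.k i = 2 → (S.σ ^ (n / 2)) x = S.β i) := by
  have hex : ∃ n, ¬ b.IsPosRoot (S.halfSteps n x) :=
    ⟨H, fun h ↦ h.not_neg (isPosRoot_neg_halfSteps hH hx)⟩
  obtain ⟨n, hn⟩ : ∃ n, Nat.find hex = n + 1 :=
    Nat.exists_eq_succ_of_ne_zero fun h ↦ Nat.find_spec hex (by rw [h]; exact hx)
  have hle : n + 1 ≤ H :=
    hn ▸ Nat.find_min' hex fun h ↦ h.not_neg (isPosRoot_neg_halfSteps hH hx)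
  have hpos : b.IsPosRoot (S.halfSteps n x) := not_not.1 (Nat.find_min hex (by lia))
  have hneg : ¬ b.IsPosRoot (S.halfSteps (n + 1) x) := hn ▸ Nat.find_spec hex
  rw [halfSteps, LinearEquiv.mul_apply] at hneg
  -- For `I₁` the power of `σ` stops just before the sign change, at `α_i = β_i`. For `I₂` the
  -- sign-changing `τ₂` completes a factor `σ` and gives `-α_i = β_i`.
  split_ifs at hneg with hpar
  · obtain ⟨i, hi, h⟩ : ∃ i ∈ S.I₁, S.halfSteps n x = P.root i := by
      by_contra! h
      exact hneg (isPosRoot_τ₁ hpos h)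
    refine ⟨n + 1, i, by lia, hle, ?_, fun _ ↦ ?_, fun h ↦ ?_⟩
    · rw [k_of_mem₁ hi, Nat.ModEq]
      grind
    · rw [add_tsub_cancel_right, ← halfSteps_two_mul, Nat.two_mul_div_two_of_even hpar, h,
        β_of_mem₁ hi]
    · simp [k_of_mem₁ hi] at h
  · obtain ⟨i, hi, h⟩ : ∃ i ∈ S.I₂, S.halfSteps n x = P.root i := by
      by_contra! h
      exact hneg (isPosRoot_τ₂ hpos h)
    refine ⟨n + 1, i, by lia, hle, ?_, fun h ↦ ?_, fun _ ↦ ?_⟩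
    · rw [k_of_mem₂ hi, Nat.ModEq]
      grind
    · simp [k_of_mem₂ hi] at h
    · rw [← halfSteps_two_mul, Nat.two_mul_div_two_of_even (by grind), halfSteps,
        if_neg hpar, LinearEquiv.mul_apply, h, β_of_mem₂ hi, τ₂_simple hi]

lemma exists_σ_pow_eq_β' (hH : b.IsHalfPeriod H) {x : M} (hx : b.IsPosRoot x) :
    ∃ m : ℕ, ∃ i, (S.σ ^ m) x = S.β i := by
  obtain ⟨n, i, -, -, -, h₁, h₂⟩ := exists_σ_pow_eq_β (S := S) hH hx
  rcases S.mem_or_mem i with hi | hi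
  exacts [⟨_, i, h₁ (k_of_mem₁ hi)⟩, ⟨_, i, h₂ (k_of_mem₂ hi)⟩]

lemma exists_mem_orbit_of_isPosRoot (hH : b.IsHalfPeriod H) {x : M} (hx : b.IsPosRoot x) :
    ∃ i, x ∈ S.orbit (S.β i) := by
  obtain ⟨m, i, h⟩ := exists_σ_pow_eq_β' (S := S) hH hx
  exact ⟨i, mem_orbit_comm.2 (mem_orbit_iff.2 ⟨m, h⟩)⟩

lemma exists_mem_orbit (hH : b.IsHalfPeriod H) {x : M} (hx : x ∈ Set.range P.root) :
    ∃ i, x ∈ S.orbit (S.β i) := by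
  rcases isPosRoot_or_neg b hx with hx | hx
  · exact exists_mem_orbit_of_isPosRoot hH hx
  -- For a negative root, the trajectory of `-x` shows that `x` reaches `-β_i`. This is positive for
  -- `i ∈ I₂`, and becomes positive after one more `σ` for `i ∈ I₁`.
  obtain ⟨m, hm⟩ : ∃ m : ℕ, b.IsPosRoot ((S.σ ^ m) x) := by
    obtain ⟨m, i, h⟩ := exists_σ_pow_eq_β' (S := S) hH hx
    rw [map_neg, neg_eq_iff_eq_neg] at h
    rcases S.mem_or_mem i with hi | hi
    · refine ⟨m + 1, ?_⟩
      rw [pow_succ', LinearEquiv.mul_apply, h, β_of_mem₁ hi, σ_apply, map_neg, τ₁_simple hi, neg_neg]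
      refine isPosRoot_τ₂ (isPosRoot_simple i) fun j hj hij ↦ notMem₁ hj ?_
      rwa [← Subtype.ext (P.root.injective hij)]
    · refine ⟨m, ?_⟩
      rw [h, β_of_mem₂ hi, neg_neg]
      exact isPosRoot_simple i
  obtain ⟨i, hi⟩ := exists_mem_orbit_of_isPosRoot (S := S) hH hm
  refine ⟨i, ?_⟩
  rw [← orbit_eq_of_mem hi, mem_orbit_comm]
  exact mem_orbit_iff.2 ⟨m, rfl⟩

lemma eq_of_mem_orbit (hH : b.IsHalfPeriod H) {x : M} {i j : b.support}
    (hi : x ∈ S.orbit (S.β i)) (hj : x ∈ S.orbit (S.β j)) : i = j := by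
  refine eq_of_β_mem_orbit (S := S) hH ?_
  rwa [← orbit_eq_of_mem hj, mem_orbit_comm]

/-- The roots are listed without repetition by `zigzag (S.color i + 2 * m) i` with `0 ≤ m < H`. -/
lemma card_eq_mul (S : b.Bipartition ψ) (hH : b.IsHalfPeriod H) :
    Nat.card ι = H * b.support.card := by
  have hHpos := hH.pos
  choose g hg using fun p : Fin H × b.support ↦
    S.zigzag_mem_range (S.color p.2 + 2 * ((p.1 : ℕ) : ℤ)) p.2
  suffices Function.Bijective g by simpa using (Nat.card_eq_of_bijective g this).symm
  constructor
  · rintro ⟨⟨m, hm⟩, i⟩ ⟨⟨n, hn⟩, j⟩ h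
    have h' := (hg (⟨m, hm⟩, i)).symm.trans (h ▸ hg (⟨n, hn⟩, j))
    obtain rfl : i = j := eq_of_mem_orbit (S := S) hH (mem_orbit_β_iff.2 ⟨m, rfl⟩)
      (mem_orbit_β_iff.2 ⟨n, h'.symm⟩)
    simp only at h'
    rw [Prod.mk.injEq, Fin.ext_iff]
    refine ⟨?_, rfl⟩
    by_contra hne
    rcases lt_or_gt_of_ne hne with hlt | hlt
    · exact zigzag_ne hH S (by grind) (by lia) (by lia) i h'
    · exact zigzag_ne hH S (by grind) (by lia) (by lia) i h'.symm
  · intro φ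
    obtain ⟨i, hi⟩ := exists_mem_orbit (S := S) hH ⟨φ, rfl⟩
    obtain ⟨k, hk⟩ := mem_orbit_β_iff.1 hi
    have h₁ := Int.emod_nonneg k (b := H) (by lia)
    have h₂ := Int.emod_lt_of_pos k (b := H) (by lia)
    refine ⟨(⟨(k % H).toNat, by lia⟩, i), P.root.injective ?_⟩
    rw [hg, ← hk]
    simp only [Int.toNat_of_nonneg h₁]
    rw [← hH.zigzag_add_mul _ (k / H), add_assoc, ← mul_add, Int.emod_add_mul_ediv]

lemma coxeterNumber_eq (S : b.Bipartition ψ) (hH : b.IsHalfPeriod H) (i : b.support) :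
    b.coxeterNumber = H := by
  rw [coxeterNumber, S.card_eq_mul hH, Nat.mul_div_cancel]
  exact Finset.card_pos.2 ⟨i, i.2⟩

lemma existsUnique_σ_pow_eq_β (hH : b.IsHalfPeriod H) {x : M} (hx : b.IsPosRoot x)
    {i : b.support} (hi : x ∈ S.orbit (S.β i)) :
    ∃! n : ℕ, 1 ≤ n ∧ n ≤ H ∧ n ≡ S.k i [MOD 2] ∧
      (S.k i = 1 → (S.σ ^ ((n - 1) / 2)) x = S.β i) ∧
      (S.k i = 2 → (S.σ ^ (n / 2)) x = S.β i) := by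
  -- Both parity cases say that `x` sits at index `n` of the `i`-th zigzag, so uniqueness reduces to
  -- `zigzag_ne`.
  have hz {n : ℕ} (hn : 1 ≤ n ∧ n ≤ H ∧ n ≡ S.k i [MOD 2] ∧
      (S.k i = 1 → (S.σ ^ ((n - 1) / 2)) x = S.β i) ∧
      (S.k i = 2 → (S.σ ^ (n / 2)) x = S.β i)) : b.zigzag n i = x := by
    obtain ⟨hn₁, -, hn₂, h₁, h₂⟩ := hn
    have key {m : ℕ} (h : (S.σ ^ m) x = S.β i) : b.zigzag (S.color i + 2 * m) i = x := by
      apply (S.σ ^ m).injective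
      have h' := σ_zpow_zigzag (S := S) (n := S.color i + 2 * m) (i := i) (by grind) m
      rw [zpow_natCast, add_sub_cancel_right] at h'
      rw [h, h', β_eq_zigzag]
    rcases S.mem_or_mem i with hi | hi
    · rw [k_of_mem₁ hi, Nat.ModEq] at hn₂
      rw [← key (h₁ (k_of_mem₁ hi)), color_of_mem₁ hi]
      congr 1
      lia
    · rw [k_of_mem₂ hi, Nat.ModEq] at hn₂
      rw [← key (h₂ (k_of_mem₂ hi)), color_of_mem₂ hi]
      congr 1
      lia
  obtain ⟨n, j, hn⟩ := exists_σ_pow_eq_β (S := S) hH hx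
  obtain rfl : i = j := by
    refine eq_of_mem_orbit (S := S) hH hi (mem_orbit_comm.2 ?_)
    rcases S.mem_or_mem j with hj | hj
    exacts [mem_orbit_iff.2 ⟨((n - 1) / 2 : ℕ), hn.2.2.2.1 (k_of_mem₁ hj)⟩,
      mem_orbit_iff.2 ⟨(n / 2 : ℕ), hn.2.2.2.2 (k_of_mem₂ hj)⟩]
  refine ⟨n, hn, fun m hm ↦ ?_⟩
  have hmn : m % 2 = n % 2 := hm.2.2.1.trans hn.2.2.1.symm
  have h := (hz hm).trans (hz hn).symm
  by_contra hne
  rcases lt_or_gt_of_ne hne with hlt | hlt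
  · exact zigzag_ne hH S (by grind) (by lia) (by lia) i h
  · exact zigzag_ne hH S (by grind) (by lia) (by lia) i h.symm

end Bipartition

end

end RootPairing.Base

/-! ### Bipartite structure of the Dynkin diagrams of the listed types -/

/-- The matrix with zero diagonal that agrees with `-C` off the diagonal: for a simply laced Cartan
matrix `C`, the adjacency matrix of its Dynkin diagram. -/
def Matrix.negOffDiag {I : Type*} [DecidableEq I] (C : Matrix I I ℤ) : Matrix I I ℤ :=
  Matrix.of fun i j ↦ if i = j then 0 else -C i j

/-- A function `rank` exhibiting `A` as (weighted) adjacency matrix of a connected bipartite graph,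
coloured by the parity of `rank`, which has a vertex of valency at least three unless all its
vertices of valency at most one have the same colour. -/
structure Matrix.IsBipartiteRank {I : Type*} [Fintype I] (A : Matrix I I ℤ) (rank : I → ℕ) :
    Prop where
  exists_parent : ∀ i, rank i ≠ 0 → ∃ j, A i j ≠ 0 ∧ A j i ≠ 0 ∧ rank j < rank i
  eq_of_rank_eq_zero : ∀ i j, rank i = 0 → rank j = 0 → i = j
  odd_add : ∀ i j, A i j ≠ 0 → Odd (rank i + rank j)
  even_add : (∀ v, ∑ u, A u v ≤ 2) → ∀ i j, ∑ u, A u i ≤ 1 → ∑ u, A u j ≤ 1 →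
    Even (rank i + rank j)

namespace Matrix.IsBipartiteRank

lemma submatrix {I J : Type*} [Fintype I] [Fintype J] {A : Matrix J J ℤ} {rank : J → ℕ}
    (h : A.IsBipartiteRank rank) (e : I ≃ J) : (A.submatrix e e).IsBipartiteRank (rank ∘ e) where
  exists_parent i hi := by
    obtain ⟨j, hj⟩ := h.exists_parent (e i) hi
    exact ⟨e.symm j, by simpa using hj⟩
  eq_of_rank_eq_zero i j hi hj := e.injective (h.eq_of_rank_eq_zero _ _ hi hj)
  odd_add i j hij := h.odd_add _ _ hij
  even_add hv i j hi hj := by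
    simp only [submatrix_apply] at hv hi hj
    rw [e.sum_comp fun u ↦ A u _] at hi hj
    refine h.even_add (fun v ↦ ?_) _ _ hi hj
    have := hv (e.symm v)
    rwa [e.sum_comp fun u ↦ A u _, e.apply_symm_apply] at this

/-- Descending through parents joins every vertex to the only vertex of rank 0. -/
lemma mem_of_closed {I : Type*} [Fintype I] {A : Matrix I I ℤ} {rank : I → ℕ}
    (h : A.IsBipartiteRank rank) {X : Set I} (hne : X.Nonempty)
    (hX : ∀ i ∈ X, ∀ j, A i j ≠ 0 → j ∈ X) (i : I) : i ∈ X := by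
  have key (n : ℕ) : ∀ i, rank i = n → ∃ r, rank r = 0 ∧ (i ∈ X ↔ r ∈ X) := by
    induction n using Nat.strong_induction_on with
    | _ n ih =>
      rintro i rfl
      by_cases hi : rank i = 0
      · exact ⟨i, hi, Iff.rfl⟩
      · obtain ⟨j, hij, hji, hlt⟩ := h.exists_parent i hi
        obtain ⟨r, hr, hjr⟩ := ih _ hlt j rfl
        exact ⟨r, hr, Iff.trans ⟨fun hi ↦ hX i hi j hij, fun hj ↦ hX j hj i hji⟩ hjr⟩
  obtain ⟨j, hj⟩ := hne
  obtain ⟨r, hr, hjr⟩ := key _ j rfl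
  obtain ⟨r', hr', hir⟩ := key _ i rfl
  rw [hir, h.eq_of_rank_eq_zero _ _ hr' hr, ← hjr]
  exact hj

lemma of_decide {n : ℕ} {A : Fin n → Fin n → ℤ} {rank : Fin n → ℕ} (v : Fin n)
    (h : decide ((∀ i, rank i ≠ 0 → ∃ j, A i j ≠ 0 ∧ A j i ≠ 0 ∧ rank j < rank i) ∧
      (∀ i j, rank i = 0 → rank j = 0 → i = j) ∧
      (∀ i j, A i j ≠ 0 → Odd (rank i + rank j)) ∧ 2 < ∑ u, A u v) = true) :
    (Matrix.of A).IsBipartiteRank rank := by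
  obtain ⟨h₁, h₂, h₃, h₄⟩ := of_decide_eq_true h
  exact ⟨h₁, h₂, h₃, fun h ↦ absurd (h v) h₄.not_ge⟩

end Matrix.IsBipartiteRank

namespace CartanMatrix

lemma negOffDiag_A_apply {n : ℕ} (i j : Fin n) :
    (A n).negOffDiag i j = if i.val + 1 = j.val ∨ j.val + 1 = i.val then 1 else 0 := by
  simp only [Matrix.negOffDiag, A, Matrix.of_apply, Fin.ext_iff]
  split_ifs <;> first | rfl | lia

lemma negOffDiag_D_apply {n : ℕ} (hn : 4 ≤ n) (i j : Fin n) :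
    (D n).negOffDiag i j =
      if (i.val + 1 = j.val ∧ j.val + 1 < n) ∨ (j.val + 1 = i.val ∧ i.val + 1 < n) ∨
        (i.val + 2 = j.val ∧ j.val + 1 = n) ∨ (j.val + 2 = i.val ∧ i.val + 1 = n)
      then 1 else 0 := by
  simp only [Matrix.negOffDiag, D, Matrix.of_apply, Fin.ext_iff]
  split_ifs <;> first | rfl | lia

/-- The vertices of valency at most one are among the two ends 0 and `2 * n`, which have the same
parity because the number of vertices is odd. -/
lemma isBipartiteRank_A (n : ℕ) :
    (A (2 * n + 1)).negOffDiag.IsBipartiteRank fun i ↦ i where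
  exists_parent i hi := by
    refine ⟨⟨i - 1, by lia⟩, ?_, ?_, ?_⟩ <;> simp only [negOffDiag_A_apply, ne_eq] <;> grind
  eq_of_rank_eq_zero i j hi hj := Fin.ext (hi.trans hj.symm)
  odd_add i j hij := by
    simp only [negOffDiag_A_apply] at hij
    grind
  even_add _ := by
    have key (i : Fin (2 * n + 1)) (hi : ∑ u, (A (2 * n + 1)).negOffDiag u i ≤ 1) :
        i.val = 0 ∨ i.val = 2 * n := by
      by_contra! h
      have := Finset.add_le_sum (s := Finset.univ)
        (f := fun u ↦ (A (2 * n + 1)).negOffDiag u i) (fun u _ ↦ by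
          rw [negOffDiag_A_apply]; split_ifs <;> simp)
        (i := ⟨i - 1, by lia⟩) (j := ⟨i + 1, by lia⟩) (Finset.mem_univ _) (Finset.mem_univ _)
        (by simp [Fin.ext_iff])
      simp only [negOffDiag_A_apply] at this hi
      grind
    intro i j hi hj
    have := key i hi
    have := key j hj
    grind

/-- The last vertex is attached to `n - 3`, hence its rank `n - 2`. The branch vertex `n - 3` has
three neighbours, so `even_add` is vacuous. -/
lemma isBipartiteRank_D {n : ℕ} (hn : 4 ≤ n) :
    (D n).negOffDiag.IsBipartiteRank fun i ↦ if i.val + 1 = n then n - 2 else i where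
  exists_parent i hi := by
    refine ⟨⟨if i.val + 1 = n then n - 3 else i - 1, by split_ifs <;> lia⟩, ?_, ?_, ?_⟩ <;>
      simp only [negOffDiag_D_apply hn, ne_eq] <;> grind
  eq_of_rank_eq_zero i j hi hj := by
    refine Fin.ext ?_
    grind
  odd_add i j hij := by
    simp only [negOffDiag_D_apply hn] at hij
    grind
  even_add h := by
    exfalso
    have h' := h ⟨n - 3, by lia⟩
    have := Finset.sum_le_univ_sum_of_nonneg
      (f := fun u ↦ (D n).negOffDiag u ⟨n - 3, by lia⟩) (fun u ↦ by
          rw [negOffDiag_D_apply hn]; split_ifs <;> simp)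
      (s := {⟨n - 4, by lia⟩, ⟨n - 2, by lia⟩, ⟨n - 1, by lia⟩})
    rw [Finset.sum_insert (by simp; lia), Finset.sum_pair (by simp; lia)] at this
    simp only [negOffDiag_D_apply hn] at this h'
    grind

/-- In types E the rank is the distance to the branch vertex 3. -/
lemma isBipartiteRank_E₆ : E₆.negOffDiag.IsBipartiteRank ![2, 1, 1, 0, 1, 2] :=
  .of_decide 3 (by decide +kernel)

lemma isBipartiteRank_E₇ : E₇.negOffDiag.IsBipartiteRank ![2, 1, 1, 0, 1, 2, 3] :=
  .of_decide 3 (by decide +kernel)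

lemma isBipartiteRank_E₈ : E₈.negOffDiag.IsBipartiteRank ![2, 1, 1, 0, 1, 2, 3, 4] :=
  .of_decide 3 (by decide +kernel)

end CartanMatrix

/-! ### Coefficients and pairings of the highest root -/

namespace RootPairing.Base

section

open scoped Classical

variable {ι R M N : Type*} [Field R] [CharZero R] [AddCommGroup M] [Module R M]
  [AddCommGroup N] [Module R N] {P : RootPairing ι R M N} [P.IsCrystallographic]
  {b : P.Base}

lemma adjacency_eq_submatrix {J : Type*} [DecidableEq J] {C : Matrix J J ℤ} (e : b.support ≃ J)
    (h : b.cartanMatrix = C.submatrix e e) : b.adjacency = C.negOffDiag.submatrix e e := by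
  ext i j
  simp [adjacency, Matrix.negOffDiag, h]

lemma IsTypeAOddOrDOrE.exists_isBipartiteRank (hb : b.IsTypeAOddOrDOrE) :
    ∃ rank : b.support → ℕ, b.adjacency.IsBipartiteRank rank := by
  obtain ⟨n, e, h⟩ | ⟨n, hn, e, h⟩ | ⟨e, h⟩ | ⟨e, h⟩ | ⟨e, h⟩ := hb <;>
    rw [adjacency_eq_submatrix e h]
  exacts [⟨_, (CartanMatrix.isBipartiteRank_A n).submatrix e⟩,
    ⟨_, (CartanMatrix.isBipartiteRank_D hn).submatrix e⟩,
    ⟨_, CartanMatrix.isBipartiteRank_E₆.submatrix e⟩,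
    ⟨_, CartanMatrix.isBipartiteRank_E₇.submatrix e⟩,
    ⟨_, CartanMatrix.isBipartiteRank_E₈.submatrix e⟩]

lemma adjacency_ne_zero_symm {i j : b.support} (h : b.adjacency i j ≠ 0) :
    b.adjacency j i ≠ 0 := by
  rw [adjacency_ne_zero_iff] at h ⊢
  rw [ne_eq (b.cartanMatrix j i), b.cartanMatrix_apply_eq_zero_iff_symm]
  exact ⟨h.1.symm, h.2⟩

lemma isOrthogonal_of_adjacency_eq_zero {i j : b.support} (hij : i ≠ j)
    (h : b.adjacency i j = 0) : P.IsOrthogonal i j := by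
  have := not_and.1 (adjacency_ne_zero_iff.not_right.1 h) hij
  rw [not_not, b.cartanMatrix_apply_eq_zero_iff_pairing] at this
  exact ⟨this, P.pairing_eq_zero_iff'.1 this⟩

namespace IsHighestRoot

variable {ψ : ι} (hψ : b.IsHighestRoot ψ)
include hψ

lemma exists_eq_sum : ∃ c : b.support → ℤ, (∀ i, 1 ≤ c i) ∧ P.root ψ = ∑ i, c i • P.root i := by
  obtain ⟨c, hc⟩ : ∃ c : b.support → ℤ, P.root ψ = ∑ i, c i • P.root i := by
    rcases isPosRoot_or_neg b ⟨ψ, rfl⟩ with h | h <;> obtain ⟨c, -, hc⟩ := h.exists_eq_sum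
    exacts [⟨c, hc⟩, ⟨-c, by simp [← neg_eq_iff_eq_neg, hc]⟩]
  refine ⟨c, fun i ↦ ?_, hc⟩
  obtain ⟨f, hf, h⟩ := exists_eq_sum_smul_root_of_mem_closure (hψ i)
  have h' : c = f + Pi.single i 1 := by
    refine sum_smul_root_injective (b := b) ?_
    rw [← hc, ← sub_add_cancel (P.root ψ) (P.root i), h]
    simp [add_smul, Finset.sum_add_distrib, Pi.single_apply]
  simpa [h'] using hf i

/-- The difference of `ψ` and its reflection in `α_i` is the pairing times `α_i`, and it must lie in
the cone of the simple roots. -/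
lemma pairingIn_nonneg (i : b.support) : 0 ≤ P.pairingIn ℤ ψ i := by
  obtain ⟨f, hf, h⟩ := exists_eq_sum_smul_root_of_mem_closure (hψ (P.reflectionPerm i ψ))
  rw [P.root_reflectionPerm, P.reflection_apply_root' ℤ, sub_sub_cancel] at h
  have h' : Pi.single i (P.pairingIn ℤ ψ i) = f := by
    refine sum_smul_root_injective (b := b) ?_
    rw [← h]
    simp [Pi.single_apply]
  simpa [← h'] using hf i

end IsHighestRoot

end

end RootPairing.Base

/-! ### Existence and uniqueness of the partition -/

namespace RootPairing.Base

section

open scoped Classical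

variable {ι R M N : Type*} [Field R] [CharZero R] [AddCommGroup M] [Module R M]
  [AddCommGroup N] [Module R N] {P : RootPairing ι R M N} [P.IsCrystallographic]
  {b : P.Base}

lemma sum_mul_pairingIn_eq_two {φ : ι} {c : b.support → ℤ} (h : P.root φ = ∑ i, c i • P.root i) :
    ∑ i, c i * P.pairingIn ℤ i φ = 2 := by
  have h' := congrArg (P.coroot' φ) h
  apply Int.cast_injective (α := R)
  simpa [eq_comm, ← P.algebraMap_pairingIn ℤ] using h'

lemma pairingIn_eq_of_eq_sum {φ : ι} {c : b.support → ℤ} (h : P.root φ = ∑ i, c i • P.root i)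
    (i : b.support) : P.pairingIn ℤ φ i = 2 * c i - ∑ j, c j * b.adjacency j i := by
  apply Int.cast_injective (α := R)
  have h' := coroot'_sum_smul_root c i
  rw [← h, P.root_coroot'_eq_pairing, ← P.algebraMap_pairingIn ℤ] at h'
  exact h'

lemma isOrthogonal_of_pairingIn_eq_zero {φ φ' : ι} (h : P.pairingIn ℤ φ φ' = 0) :
    P.IsOrthogonal φ φ' := by
  have : P.pairing φ φ' = 0 := by rw [← P.algebraMap_pairingIn ℤ, h, map_zero]
  exact ⟨this, P.pairing_eq_zero_iff'.1 this⟩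

lemma pairingIn_eq_zero_of_isOrthogonal {φ φ' : ι} (h : P.IsOrthogonal φ φ') :
    P.pairingIn ℤ φ φ' = 0 := by
  apply Int.cast_injective (α := R)
  simpa [← P.algebraMap_pairingIn ℤ] using h.1

namespace IsHighestRoot

variable [Finite ι] {ψ : ι} (hψ : b.IsHighestRoot ψ)
include hψ

lemma pairingIn_nonneg' (i : b.support) : 0 ≤ P.pairingIn ℤ i ψ := by
  have h := hψ.pairingIn_nonneg i
  contrapose! h
  exact P.pairingIn_lt_zero_iff ℤ |>.1 h

lemma exists_pairingIn_ne_zero : ∃ i : b.support, P.pairingIn ℤ i ψ ≠ 0 := by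
  obtain ⟨c, -, hc⟩ := hψ.exists_eq_sum
  by_contra! h
  simpa [h] using sum_mul_pairingIn_eq_two hc

/-- If the highest root is not orthogonal to two distinct simple roots, then it is the sum of all
the simple roots. -/
lemma eq_one_of_pairingIn_ne_zero {rank : b.support → ℕ} (hr : b.adjacency.IsBipartiteRank rank)
    {c : b.support → ℤ} (hc₁ : ∀ i, 1 ≤ c i) (hc : P.root ψ = ∑ i, c i • P.root i)
    {i j : b.support} (hij : i ≠ j) (hi : P.pairingIn ℤ i ψ ≠ 0) (hj : P.pairingIn ℤ j ψ ≠ 0)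
    (v : b.support) : c v = 1 := by
  -- The sum of all `c k * ⟨α_k, ψ^∨⟩` is 2 with nonnegative terms, and the terms of `i` and `j` are
  -- each at least 1.
  have hci : c i ≤ 1 := by
    have h := Finset.add_le_sum (s := Finset.univ) (f := fun i ↦ c i * P.pairingIn ℤ i ψ)
      (fun i _ ↦ mul_nonneg (by have := hc₁ i; lia) (hψ.pairingIn_nonneg' i))
      (Finset.mem_univ i) (Finset.mem_univ j) hij
    rw [sum_mul_pairingIn_eq_two hc] at h
    have := hψ.pairingIn_nonneg' i
    have := hψ.pairingIn_nonneg' j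
    have := hc₁ i
    have := hc₁ j
    have : 1 ≤ P.pairingIn ℤ i ψ := by lia
    have : 1 ≤ P.pairingIn ℤ j ψ := by lia
    nlinarith
  have hdi : 1 ≤ P.pairingIn ℤ ψ i := by
    have := hψ.pairingIn_nonneg i
    have : P.pairingIn ℤ ψ i ≠ 0 := fun h ↦
      hi (pairingIn_eq_zero_of_isOrthogonal (isOrthogonal_of_pairingIn_eq_zero h).symm)
    lia
  have hnn (u v : b.support) : 0 ≤ c u * b.adjacency u v :=
    mul_nonneg (by have := hc₁ u; lia) (adjacency_nonneg u v)
  have hle {u v : b.support} (huv : b.adjacency u v ≠ 0) : c u ≤ c u * b.adjacency u v := by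
    have := hc₁ u
    have := adjacency_nonneg u v
    exact le_mul_of_one_le_right (by lia) (by lia)
  have hone {u : b.support} (h : c u ≤ 1) : c u = 1 := le_antisymm h (hc₁ u)
  -- Nonnegativity of the pairing at `v` bounds the weighted sum of neighbouring coefficients by `2
  -- * c v = 2`. One neighbour with coefficient 1 therefore forces 1 on any other; at `i` the
  -- pairing is at least 1, which provides the first such neighbour.
  refine (hr.mem_of_closed (X := {v | c v = 1 ∧ ∃ u, b.adjacency v u ≠ 0 ∧ c u = 1}) ⟨i, hone hci, ?_⟩ (fun v ⟨hv, u, hvu, hu⟩ w hvw ↦ ?_) v).1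
  · obtain ⟨u, hu⟩ : ∃ u, b.adjacency i u ≠ 0 := by
      by_contra! h
      exact hij (hr.mem_of_closed (X := {i}) ⟨i, rfl⟩
        (fun k hk l hkl ↦ absurd (h l) (by rwa [← Set.mem_singleton_iff.1 hk])) j).symm
    refine ⟨u, hu, hone ?_⟩
    have h := Finset.single_le_sum (s := Finset.univ) (f := fun u ↦ c u * b.adjacency u i)
      (fun u _ ↦ hnn u i) (Finset.mem_univ u)
    have h' := pairingIn_eq_of_eq_sum hc i
    have := hle (adjacency_ne_zero_symm hu)
    lia
  · refine ⟨?_, v, adjacency_ne_zero_symm hvw, hv⟩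
    by_cases hwu : w = u
    · rw [hwu, hu]
    · have h := Finset.add_le_sum (s := Finset.univ) (f := fun u ↦ c u * b.adjacency u v)
        (fun u _ ↦ hnn u v) (Finset.mem_univ w) (Finset.mem_univ u) hwu
      have h' := pairingIn_eq_of_eq_sum hc v
      have := hle (adjacency_ne_zero_symm hvw)
      have := hle (adjacency_ne_zero_symm hvu)
      have := hψ.pairingIn_nonneg v
      exact hone (by lia)

/-- If two distinct simple roots pair nontrivially with `ψ`, all coefficients of `ψ` are 1, so the
valency at `v` is `2 - ⟨ψ, α_v^∨⟩`. It is at most 2 everywhere and at most 1 at `i` and `j`, the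
situation covered by `even_add`. -/
lemma even_rank_add_rank {rank : b.support → ℕ} (hr : b.adjacency.IsBipartiteRank rank)
    {i j : b.support} (hi : P.pairingIn ℤ i ψ ≠ 0) (hj : P.pairingIn ℤ j ψ ≠ 0) :
    Even (rank i + rank j) := by
  by_cases hij : i = j
  · rw [hij]
    exact ⟨_, rfl⟩
  obtain ⟨c, hc₁, hc⟩ := hψ.exists_eq_sum
  have h₁ := hψ.eq_one_of_pairingIn_ne_zero hr hc₁ hc hij hi hj
  have hs (v : b.support) : ∑ u, b.adjacency u v = 2 - P.pairingIn ℤ ψ v := by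
    rw [pairingIn_eq_of_eq_sum hc]
    simp [h₁]
  have hpos {i : b.support} (hi : P.pairingIn ℤ i ψ ≠ 0) : ∑ u, b.adjacency u i ≤ 1 := by
    have := hψ.pairingIn_nonneg i
    have : P.pairingIn ℤ ψ i ≠ 0 := fun h ↦
      hi (pairingIn_eq_zero_of_isOrthogonal (isOrthogonal_of_pairingIn_eq_zero h).symm)
    rw [hs]
    lia
  refine hr.even_add (fun v ↦ ?_) i j (hpos hi) (hpos hj)
  have := hψ.pairingIn_nonneg v
  rw [hs]
  lia

end IsHighestRoot

namespace Bipartition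

variable [Finite ι] {ψ : ι}

/-- The partition of the simple roots by the parity of `rank`. -/
noncomputable def ofRank {rank : b.support → ℕ} (hr : b.adjacency.IsBipartiteRank rank)
    (hψ : b.IsHighestRoot ψ) {i₀ : b.support} (hi₀ : P.pairingIn ℤ i₀ ψ ≠ 0) :
    b.Bipartition ψ where
  I₁ := {i | Even (rank i + rank i₀)}
  I₂ := {i | ¬ Even (rank i + rank i₀)}
  disjoint := Finset.disjoint_filter_filter_not _ _ _
  mem_or_mem i := by simpa using Nat.even_or_odd _
  orthogonal₁ i hi j hj hij := by
    refine isOrthogonal_of_adjacency_eq_zero hij (by_contra fun h ↦ ?_)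
    have := hr.odd_add i j h
    simp only [Finset.mem_filter_univ] at hi hj
    grind
  orthogonal₂ i hi j hj hij := by
    refine isOrthogonal_of_adjacency_eq_zero hij (by_contra fun h ↦ ?_)
    have := hr.odd_add i j h
    simp only [Finset.mem_filter_univ] at hi hj
    grind
  orthogonal_highest i hi := by
    refine isOrthogonal_of_pairingIn_eq_zero (by_contra fun h ↦ ?_)
    rw [Finset.mem_filter_univ] at hi
    exact hi (hψ.even_rank_add_rank hr h hi₀)

lemma mem₁_of_pairingIn_ne_zero (S : b.Bipartition ψ) {i : b.support}
    (hi : P.pairingIn ℤ i ψ ≠ 0) : i ∈ S.I₁ :=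
  (S.mem_or_mem i).resolve_right fun h ↦
    hi (pairingIn_eq_zero_of_isOrthogonal (S.orthogonal_highest i h))

lemma mem₁_iff_of_adjacency_ne_zero (S : b.Bipartition ψ) {i j : b.support}
    (h : b.adjacency i j ≠ 0) : j ∈ S.I₁ ↔ i ∉ S.I₁ := by
  have := S.odd_color_add_color h
  simp only [color] at this
  split_ifs at this <;> first | (simp_all; done) | exact absurd this (by decide)

lemma mem₂_iff (S : b.Bipartition ψ) {i : b.support} : i ∈ S.I₂ ↔ i ∉ S.I₁ :=
  ⟨notMem₁, (S.mem_or_mem i).resolve_left⟩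

/-- Both partitions put `i₀` into the first part, and membership alternates along edges. -/
lemma eq_of_isConnected (hconn : b.IsConnected) {i₀ : b.support} (hi₀ : P.pairingIn ℤ i₀ ψ ≠ 0)
    (S S' : b.Bipartition ψ) : S = S' := by
  have key : ∀ i, i ∈ {i | i ∈ S.I₁ ↔ i ∈ S'.I₁} := by
    refine hconn _ ⟨i₀, ?_⟩ fun i hi j hij ↦ ?_
    · simp [mem₁_of_pairingIn_ne_zero _ hi₀]
    · rw [Set.mem_ofPred_eq, S.mem₁_iff_of_adjacency_ne_zero hij,
        S'.mem₁_iff_of_adjacency_ne_zero hij]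
      exact not_congr hi
  ext i
  · exact key i
  · rw [mem₂_iff, mem₂_iff]
    exact not_congr (key i)

end Bipartition

end

end RootPairing.Base

/-- `P` is the root system `Δ`, `b` the base `Π`, `ψ` the highest root. The partition of `Π` exists
and is unique; for each positive root `φ` there is a unique index `i = i_φ` with `φ ∈ Z · β_i`, and
the asserted unique integer `n = n(φ)` exists. -/
theorem theorem1p11 {ι R M N : Type*} [Finite ι] [Field R] [CharZero R]
    [AddCommGroup M] [Module R M] [AddCommGroup N] [Module R N]
    (P : RootPairing ι R M N) [P.IsRootSystem] [P.IsCrystallographic] [P.IsReduced]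
    (b : P.Base) (hb : b.IsTypeAOddOrDOrE) (ψ : ι) (hψ : b.IsHighestRoot ψ) :
    ∃ S : b.Bipartition ψ, (∀ S' : b.Bipartition ψ, S' = S) ∧
      ∀ φ : ι, b.IsPos φ →
        (∃! i : b.support, P.root φ ∈ S.orbit (S.β i)) ∧
        ∀ i : b.support, P.root φ ∈ S.orbit (S.β i) →
          ∃! n : ℕ, 1 ≤ n ∧ n ≤ b.coxeterNumber ∧ n ≡ S.k i [MOD 2] ∧
            (S.k i = 1 → (S.σ ^ ((n - 1) / 2)) (P.root φ) = S.β i) ∧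
            (S.k i = 2 → (S.σ ^ (n / 2)) (P.root φ) = S.β i) := by
  obtain ⟨rank, hr⟩ := hb.exists_isBipartiteRank
  obtain ⟨i₀, hi₀⟩ := hψ.exists_pairingIn_ne_zero
  have hconn : b.IsConnected := fun X hX h ↦ hr.mem_of_closed hX h
  let S : b.Bipartition ψ := .ofRank hr hψ hi₀
  obtain ⟨H, hH⟩ := S.exists_isHalfPeriod hconn i₀
  refine ⟨S, fun S' ↦ RootPairing.Base.Bipartition.eq_of_isConnected hconn hi₀ S' S, fun φ hφ ↦ ?_⟩
  replace hφ := RootPairing.Base.isPosRoot_root.2 hφ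
  rw [S.coxeterNumber_eq hH i₀]
  obtain ⟨i, hi⟩ := RootPairing.Base.Bipartition.exists_mem_orbit_of_isPosRoot (S := S) hH hφ
  exact ⟨⟨i, hi, fun j hj ↦ RootPairing.Base.Bipartition.eq_of_mem_orbit hH hj hi⟩,
    fun j hj ↦ RootPairing.Base.Bipartition.existsUnique_σ_pow_eq_β hH hφ hj⟩
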